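/- **Theorem 8.3.** Let $T$ be a compact metric topological group, written additively (not necessarily commutative), and let $\mu$ be a non-zero $\sigma$-finite Borel measure on $T$ that is invariant under all the shifts $t\mapsto t+h$, $h\in T$ (that is, a Haar measure). Let $1\le a<b\le\infty$, let $Q\ge 1$ be a real number, and let $\nu$ be a $\sigma$-finite Borel measure with $\nu([a,b])\neq 0$ such that $b<\infty$ or $\nu(\{\infty\})=0$. Let $G=G^{(Q)}_{\mu,\nu}(a,b)$ be the integral grand Lebesgue space, that is, the space of all measurable functions $f:T\to\mathbb R$, identified when they are equal $\mu$-almost everywhere, with finite norm $$\langle f\rangle=\left[\int_{[a,b]}|f|_p^{\,Q}\,\nu(dp)\right]^{1/Q},\qquad |f|_p=\|f\|_{L_p(T,\mu)} .$$ For $h\in T$ put $\Theta_h f(t)=f(t+h)-f(t)$. Then a subset $F\subset G$ is compact in $G$ if and only if it is bounded, closed and $$\lim_{h\to 0}\ \sup_{f\in F}\ \langle\Theta_h f\rangle=0 .$$ -/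

import Mathlib

open MeasureTheory Set Filter Topology
open scoped ENNReal

noncomputable section

section Norm

variable {T : Type*} [MeasurableSpace T]

/-- The integral grand Lebesgue norm, with values in `[0, ∞]`, of a function `f : T → ℝ`:
`(∫_{[a,b]} |f|_p ^ Q ν(dp)) ^ (1/Q)`, where `|f|_p` is the usual norm of `L_p(T, μ)`. -/
def iglsENorm (Q : ℝ) (a b : ℝ≥0∞) (ν : Measure ℝ≥0∞) (μ : Measure T) (f : T → ℝ) : ℝ≥0∞ :=
  (∫⁻ p in Icc a b, eLpNorm f p μ ^ Q ∂ν) ^ (1 / Q)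

variable {Q : ℝ} {a b : ℝ≥0∞} {ν : Measure ℝ≥0∞} {μ : Measure T}

theorem iglsENorm_congr_ae {f g : T → ℝ} (h : f =ᵐ[μ] g) :
    iglsENorm Q a b ν μ f = iglsENorm Q a b ν μ g := by
  simp only [iglsENorm, eLpNorm_congr_ae h]

theorem measurable_eLpNorm_exponent [SFinite μ] {f : T → ℝ} (hf : AEStronglyMeasurable f μ) :
    Measurable fun p : ℝ≥0∞ => eLpNorm f p μ := by
  obtain ⟨g, hg, hfg⟩ := hf
  simp only [eLpNorm_congr_ae hfg]
  have h1 : Measurable fun p : ℝ≥0∞ =>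
      (∫⁻ t, ‖g t‖ₑ ^ p.toReal ∂μ) ^ (1 / p.toReal) := by
    refine Measurable.pow ?_ (by fun_prop)
    refine Measurable.lintegral_prod_right' (f := fun z : ℝ≥0∞ × T => ‖g z.2‖ₑ ^ z.1.toReal) ?_
    exact Measurable.pow ((hg.measurable.enorm).comp measurable_snd) (by fun_prop)
  have h2 : (fun p : ℝ≥0∞ => eLpNorm g p μ) = fun p => if p = 0 then 0 else
      if p = ∞ then eLpNormEssSup g μ else
        (∫⁻ t, ‖g t‖ₑ ^ p.toReal ∂μ) ^ (1 / p.toReal) := by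
    funext p
    simp only [eLpNorm, eLpNorm']
  rw [h2]
  exact Measurable.ite (measurableSet_singleton 0) measurable_const
    (Measurable.ite (measurableSet_singleton ∞) measurable_const h1)

theorem iglsENorm_zero (hQ : 1 ≤ Q) : iglsENorm Q a b ν μ (0 : T → ℝ) = 0 := by
  have h0 : 0 < Q := by linarith
  simp [iglsENorm, h0, ENNReal.zero_rpow_of_pos]

theorem iglsENorm_neg (f : T → ℝ) : iglsENorm Q a b ν μ (-f) = iglsENorm Q a b ν μ f := by
  simp only [iglsENorm, eLpNorm_neg]

theorem iglsENorm_const_smul (hQ : 1 ≤ Q) (c : ℝ) (f : T → ℝ) :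
    iglsENorm Q a b ν μ (c • f) = ‖c‖ₑ * iglsENorm Q a b ν μ f := by
  have h0 : 0 < Q := by linarith
  simp only [iglsENorm, eLpNorm_const_smul, ENNReal.mul_rpow_of_nonneg _ _ h0.le]
  rw [lintegral_const_mul' _ _ (by simp [h0.le]),
    ENNReal.mul_rpow_of_nonneg _ _ (by positivity), ← ENNReal.rpow_mul]
  simp [h0.ne']

theorem iglsENorm_add_le [SFinite μ] (hQ : 1 ≤ Q) (ha : 1 ≤ a) {f g : T → ℝ}
    (hf : AEStronglyMeasurable f μ) (hg : AEStronglyMeasurable g μ) :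
    iglsENorm Q a b ν μ (f + g) ≤ iglsENorm Q a b ν μ f + iglsENorm Q a b ν μ g := by
  have h0 : 0 < Q := by linarith
  refine le_trans ?_ (ENNReal.lintegral_Lp_add_le (μ := ν.restrict (Icc a b))
    (measurable_eLpNorm_exponent hf).aemeasurable
    (measurable_eLpNorm_exponent hg).aemeasurable hQ)
  refine ENNReal.rpow_le_rpow ?_ (by positivity)
  refine setLIntegral_mono' measurableSet_Icc fun p hp => ?_
  exact ENNReal.rpow_le_rpow (eLpNorm_add_le hf hg (ha.trans hp.1)) h0.le

theorem ae_eq_zero_of_iglsENorm_eq_zero [SFinite μ] [NeZero (ν.restrict (Icc a b))]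
    (hQ : 1 ≤ Q) (ha : 1 ≤ a) {f : T → ℝ} (hf : AEStronglyMeasurable f μ)
    (h : iglsENorm Q a b ν μ f = 0) : f =ᵐ[μ] 0 := by
  have h0 : 0 < Q := by linarith
  rw [iglsENorm, ENNReal.rpow_eq_zero_iff_of_pos (by positivity),
    lintegral_eq_zero_iff ((measurable_eLpNorm_exponent hf).pow_const Q)] at h
  obtain ⟨p, hp, hpI⟩ := (h.and (ae_restrict_mem measurableSet_Icc)).exists
  have hp' : eLpNorm f p μ = 0 := by
    simpa [ENNReal.rpow_eq_zero_iff_of_pos h0] using hp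
  exact (eLpNorm_eq_zero_iff hf (by
    rintro rfl; exact absurd (ha.trans hpI.1) (by simp))).1 hp'

end Norm

section Space

variable {T : Type*} [MeasurableSpace T]

/-- The integral grand Lebesgue space: the classes, modulo equality `μ`-almost everywhere, of the
measurable functions `T → ℝ` with finite integral grand Lebesgue norm. -/
def IGLS (Q : ℝ) [hQ : Fact (1 ≤ Q)] (a b : ℝ≥0∞) [ha : Fact (1 ≤ a)] (ν : Measure ℝ≥0∞)
    (μ : Measure T) [SFinite μ] : Submodule ℝ (T →ₘ[μ] ℝ) where
  carrier := {f | iglsENorm Q a b ν μ f < ∞}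
  zero_mem' := by
    rw [mem_ofPred_eq, iglsENorm_congr_ae AEEqFun.coeFn_zero, iglsENorm_zero hQ.out]
    exact ENNReal.zero_lt_top
  add_mem' {f g} hf hg := by
    rw [mem_ofPred_eq, iglsENorm_congr_ae (AEEqFun.coeFn_add f g)]
    exact (iglsENorm_add_le hQ.out ha.out f.aestronglyMeasurable g.aestronglyMeasurable).trans_lt
      (ENNReal.add_lt_top.2 ⟨hf, hg⟩)
  smul_mem' c f hf := by
    rw [mem_ofPred_eq, iglsENorm_congr_ae (AEEqFun.coeFn_smul c f), iglsENorm_const_smul hQ.out]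
    exact ENNReal.mul_lt_top (by simp) hf

variable {Q : ℝ} [hQ : Fact (1 ≤ Q)] {a b : ℝ≥0∞} [ha : Fact (1 ≤ a)] {ν : Measure ℝ≥0∞}
  {μ : Measure T} [SFinite μ]

/-- The norm of the integral grand Lebesgue space. The measure `ν` must not vanish on `[a, b]`. -/
instance IGLS.instNormedAddCommGroup [NeZero (ν.restrict (Icc a b))] :
    NormedAddCommGroup (IGLS Q a b ν μ) :=
  AddGroupNorm.toNormedAddCommGroup
    { toFun := fun f => (iglsENorm Q a b ν μ (f : T →ₘ[μ] ℝ)).toReal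
      map_zero' := by
        rw [Submodule.coe_zero, iglsENorm_congr_ae AEEqFun.coeFn_zero, iglsENorm_zero hQ.out,
          ENNReal.toReal_zero]
      add_le' := fun f g => by
        rw [Submodule.coe_add, iglsENorm_congr_ae (AEEqFun.coeFn_add _ _),
          ← ENNReal.toReal_add f.2.ne g.2.ne]
        exact ENNReal.toReal_mono (ENNReal.add_lt_top.2 ⟨f.2, g.2⟩).ne
          (iglsENorm_add_le hQ.out ha.out (AEEqFun.aestronglyMeasurable _)
            (AEEqFun.aestronglyMeasurable _))
      neg' := fun f => by
        rw [Submodule.coe_neg, iglsENorm_congr_ae (AEEqFun.coeFn_neg _), iglsENorm_neg]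
      eq_zero_of_map_eq_zero' := fun f hf => by
        have h := (ENNReal.toReal_eq_zero_iff _).1 hf
        have h' := ae_eq_zero_of_iglsENorm_eq_zero hQ.out ha.out
          (AEEqFun.aestronglyMeasurable _) (h.resolve_right f.2.ne)
        exact Subtype.ext (AEEqFun.ext (h'.trans AEEqFun.coeFn_zero.symm)) }

theorem IGLS.norm_def [NeZero (ν.restrict (Icc a b))] (f : IGLS Q a b ν μ) :
    ‖f‖ = (iglsENorm Q a b ν μ (f : T →ₘ[μ] ℝ)).toReal := rfl

end Space

/-- The difference operator `Θ_h f = f(· + h) - f`. -/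
def diffOp {T : Type*} [Add T] (h : T) (f : T → ℝ) : T → ℝ := fun t => f (t + h) - f t

end

/-! Necessity: right translation is an isometry of every `L_p`, and `Θ_h f → 0` in `L_p` for finite
`p` by density of the continuous functions. Dominated convergence in `p` carries this to `G`, since
the exponent `∞` is `ν`-null in `[a, b]`. A finite net makes it uniform over a compact set.

Sufficiency is the Riesz–Kolmogorov argument. For a continuous weight `φ ≥ 0` of integral 1 living
near 0, put `A f(t) = ∫ φ(h) f(t + h) μ(dh)`. Then `A f - f` is a `φ`-average of the `Θ_h f`, and
Minkowski's inequality in `L_p`, Jensen's inequality for the power `Q` and Tonelli's theorem bound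
its norm by the modulus of continuity (`iglsENorm_translationAverage_sub_le`). The norm of `G`
dominates that of `L_1`, so for bounded `F` the functions `A f` are uniformly bounded and
equicontinuous; by Arzelà–Ascoli they are relatively compact in `C(T)`
(`isCompact_closure_translationAverage`), which maps continuously into `G` when `ν([a, b]) < ∞`.
Hence `F` is totally bounded, and `G` is complete. If `ν([a, b]) = ∞`, then `G = {0}`. -/

set_option linter.unusedSectionVars false

/-! ### Jensen's and Minkowski's integral inequalities -/

section Minkowski

variable {X Y : Type*} [MeasurableSpace X] [MeasurableSpace Y]

/-- Jensen's inequality for powers, with respect to a probability measure. -/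
theorem rpow_lintegral_le_lintegral_rpow (m : Measure Y) [IsProbabilityMeasure m] {g : Y → ℝ≥0∞}
    (hg : AEMeasurable g m) {p : ℝ} (hp : 1 ≤ p) :
    (∫⁻ y, g y ∂m) ^ p ≤ ∫⁻ y, g y ^ p ∂m := by
  have h := eLpNorm'_le_eLpNorm'_of_exponent_le (μ := m) one_pos hp hg.aestronglyMeasurable
  simp only [eLpNorm', enorm_eq_self, ENNReal.rpow_one, div_one] at h
  have h2 := ENNReal.rpow_le_rpow h (zero_le_one.trans hp)
  rwa [← ENNReal.rpow_mul, one_div_mul_cancel (by linarith), ENNReal.rpow_one] at h2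

/-- Minkowski's integral inequality. -/
theorem rpow_lintegral_rpow_lintegral_le (μ : Measure X) [SFinite μ] (m : Measure Y)
    [IsProbabilityMeasure m] {g : X → Y → ℝ≥0∞} (hg : Measurable (Function.uncurry g))
    {p : ℝ} (hp : 1 ≤ p) {C : ℝ≥0∞} (hC : C ≠ ∞) (hgC : ∀ y, ∫⁻ x, g x y ^ p ∂μ ≤ C) :
    (∫⁻ x, (∫⁻ y, g x y ∂m) ^ p ∂μ) ^ (1 / p) ≤ ∫⁻ y, (∫⁻ x, g x y ^ p ∂μ) ^ (1 / p) ∂m := by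
  have hp0 : 0 < p := by linarith
  have hgx (x : X) : Measurable (g x) := hg.comp measurable_prodMk_left
  have hgy (y : Y) : Measurable fun x => g x y := hg.comp measurable_prodMk_right
  have hH : Measurable fun x => ∫⁻ y, g x y ∂m := hg.lintegral_prod_right'
  rcases hp.eq_or_lt with rfl | hp1
  · simp only [ENNReal.rpow_one, div_one]
    exact (lintegral_lintegral_swap hg.aemeasurable).le
  set N := ∫⁻ x, (∫⁻ y, g x y ∂m) ^ p ∂μ with hN
  set R := ∫⁻ y, (∫⁻ x, g x y ^ p ∂μ) ^ (1 / p) ∂m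
  -- The bound `C` serves only to make `N` finite, so that `N ^ (1 / q)` can be cancelled at the
  -- end.
  have hNtop : N ≠ ∞ := by
    refine ne_top_of_le_ne_top hC ?_
    calc N ≤ ∫⁻ x, ∫⁻ y, g x y ^ p ∂m ∂μ :=
          lintegral_mono fun x => rpow_lintegral_le_lintegral_rpow m (hgx x).aemeasurable hp
      _ = ∫⁻ y, ∫⁻ x, g x y ^ p ∂μ ∂m :=
          lintegral_lintegral_swap (f := fun x y => g x y ^ p) (hg.pow_const p).aemeasurable
      _ ≤ ∫⁻ _, C ∂m := lintegral_mono hgC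
      _ = C := by simp
  rcases eq_or_ne N 0 with hN0 | hN0
  · simp [hN0, hp0]
  have hpq := Real.HolderConjugate.conjExponent hp1
  set q := Real.conjExponent p
  have hq0 : 0 < q := hpq.symm.pos
  -- One of the `p` factors of the inner integral is opened; Tonelli and Hölder then apply, with `(p
  -- - 1) q = p`.
  have key : N ≤ R * N ^ (1 / q) := by
    calc N = ∫⁻ x, ∫⁻ y, g x y * (∫⁻ z, g x z ∂m) ^ (p - 1) ∂m ∂μ := by
          refine lintegral_congr fun x => ?_
          rw [lintegral_mul_const _ (hgx x)]
          have : p = 1 + (p - 1) := by ring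
          conv_lhs => rw [this]
          rw [ENNReal.rpow_add_of_nonneg _ _ zero_le_one (by linarith), ENNReal.rpow_one]
      _ = ∫⁻ y, ∫⁻ x, g x y * (∫⁻ z, g x z ∂m) ^ (p - 1) ∂μ ∂m :=
          lintegral_lintegral_swap (f := fun x y => g x y * (∫⁻ z, g x z ∂m) ^ (p - 1))
            (hg.mul ((hH.comp measurable_fst).pow_const _)).aemeasurable
      _ ≤ ∫⁻ y, (∫⁻ x, g x y ^ p ∂μ) ^ (1 / p) * N ^ (1 / q) ∂m := by
          refine lintegral_mono fun y => ?_
          refine (ENNReal.lintegral_mul_le_Lp_mul_Lq μ hpq (hgy y).aemeasurable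
            (hH.pow_const (p - 1)).aemeasurable).trans_eq ?_
          simp only [← ENNReal.rpow_mul, hpq.sub_one_mul_conj, hN]
      _ = R * N ^ (1 / q) := by
          rw [lintegral_mul_const' _ _ (ENNReal.rpow_ne_top_of_nonneg (by positivity) hNtop)]
  have hsplit : N = N ^ (1 / p) * N ^ (1 / q) := by
    rw [← ENNReal.rpow_add _ _ hN0 hNtop, one_div, one_div, hpq.inv_add_inv_eq_one,
      ENNReal.rpow_one]
  have h0 : N ^ (1 / q) ≠ 0 := by simp [hN0, hNtop, ENNReal.rpow_eq_zero_iff]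
  have ht : N ^ (1 / q) ≠ ∞ := ENNReal.rpow_ne_top_of_nonneg (by positivity) hNtop
  exact (ENNReal.mul_le_mul_iff_left h0 ht).1 (hsplit.symm.trans_le key)

end Minkowski

/-! ### Finiteness and two-sided invariance of Haar measures on compact groups -/

section Unimodular

variable {T : Type*} [TopologicalSpace T] [CompactSpace T] [SecondCountableTopology T] [AddGroup T]
  [IsTopologicalAddGroup T] [MeasurableSpace T] [BorelSpace T]

/-- Comparison with a finite Haar measure `l` gives `μ(T) l(A) = l(T) μ(A)`. A set `A` with `0 <
μ(A) < ∞` then excludes `μ(T) = ∞`. -/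
theorem isFiniteMeasure_of_isAddLeftInvariant (μ : Measure T) [SigmaFinite μ]
    [μ.IsAddLeftInvariant] : IsFiniteMeasure μ := by
  by_contra hfin
  have htop : μ univ = ∞ := by
    by_contra h
    exact hfin ⟨lt_top_iff_ne_top.2 h⟩
  set l : Measure T := Measure.addHaar
  have key := measure_add_measure_eq μ l univ
  have hl0 : l univ ≠ 0 := by simp [l, NeZero.ne]
  have hlt : l univ ≠ ∞ := measure_ne_top _ _
  obtain ⟨n, hn⟩ : ∃ n, μ (spanningSets μ n) ≠ 0 := by
    by_contra! h
    have : μ univ = 0 := by rw [← iUnion_spanningSets μ]; exact measure_iUnion_null h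
    simp [this] at htop
  have h1 := key (spanningSets μ n) hl0 hlt
  have h2 : l univ * μ (spanningSets μ n) ≠ ∞ :=
    ENNReal.mul_ne_top hlt (measure_spanningSets_lt_top μ n).ne
  rw [← h1, htop] at h2
  have h3 : l (spanningSets μ n) = 0 := by
    by_contra h
    exact h2 (ENNReal.top_mul h)
  rw [h3, mul_zero, eq_comm, mul_eq_zero] at h1
  exact h1.elim hl0 hn

/-- Left and right translations commute, so a right translate of `μ` is again left invariant and
hence a multiple of `μ`; equality of the total masses makes the factor 1. -/
theorem isAddRightInvariant_of_isAddLeftInvariant (μ : Measure T) [SigmaFinite μ]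
    [μ.IsAddLeftInvariant] : μ.IsAddRightInvariant := by
  have := isFiniteMeasure_of_isAddLeftInvariant μ
  rcases eq_or_ne μ 0 with rfl | h0
  · exact ⟨fun g => by simp⟩
  have : μ.IsAddHaarMeasure := 
    Measure.isAddHaarMeasure_of_isCompact_nonempty_interior μ univ isCompact_univ (by simp)
      (by simpa using h0) (by simp)
  refine ⟨fun g => ?_⟩
  have h1 := Measure.isAddInvariant_eq_smul_of_compactSpace (μ.map (· + g)) μ
  set c := Measure.addHaarScalarFactor (μ.map (· + g)) μ
  have h2 : (μ.map (· + g)) univ = μ univ := by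
    rw [Measure.map_apply (by fun_prop) MeasurableSet.univ, preimage_univ]
  have hc : c = 1 := by
    rw [h1, Measure.smul_apply] at h2
    have h3 : (c : ℝ≥0∞) * μ univ = 1 * μ univ := by simpa [ENNReal.smul_def] using h2
    have := (ENNReal.mul_left_inj (by simpa using h0) (measure_ne_top _ _)).1 h3
    exact_mod_cast this
  rw [h1, hc, one_smul]

/-- The reflection `t ↦ -t` exchanges left and right invariance. -/
theorem isFiniteMeasure_of_isAddRightInvariant (μ : Measure T) [SigmaFinite μ]
    [μ.IsAddRightInvariant] : IsFiniteMeasure μ := by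
  have : SigmaFinite μ.neg := (MeasurableEquiv.neg T).sigmaFinite_map
  have := isFiniteMeasure_of_isAddLeftInvariant μ.neg
  rw [← Measure.neg_neg μ]
  exact Measure.isFiniteMeasure_map _ _

/-- Compact groups are unimodular. -/
theorem isAddLeftInvariant_of_isAddRightInvariant (μ : Measure T) [SigmaFinite μ]
    [μ.IsAddRightInvariant] : μ.IsAddLeftInvariant := by
  have : SigmaFinite μ.neg := (MeasurableEquiv.neg T).sigmaFinite_map
  have := isAddRightInvariant_of_isAddLeftInvariant μ.neg
  rw [← Measure.neg_neg μ]
  infer_instance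

end Unimodular

/-! ### Comparison with `L¹` and lower semicontinuity of the norm -/

section Bounds

variable {T : Type*} [MeasurableSpace T] {Q : ℝ} {a b : ℝ≥0∞} {ν : Measure ℝ≥0∞} {μ : Measure T}

theorem ae_restrict_Icc_ne_top (hν : b < ∞ ∨ ν {∞} = 0) :
    ∀ᵐ p ∂ν.restrict (Icc a b), p ∈ Icc a b ∧ p ≠ ∞ := by
  refine (ae_restrict_mem measurableSet_Icc).and ?_
  rcases hν with hb | hν
  · filter_upwards [ae_restrict_mem measurableSet_Icc] with p hp
    exact (hp.2.trans_lt hb).ne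
  · refine ae_restrict_of_ae ?_
    rw [ae_iff]
    simpa using hν

theorem iglsENorm_mono {f g : T → ℝ} (hQ : 1 ≤ Q)
    (h : ∀ᵐ p ∂ν.restrict (Icc a b), eLpNorm f p μ ≤ eLpNorm g p μ) :
    iglsENorm Q a b ν μ f ≤ iglsENorm Q a b ν μ g := by
  refine ENNReal.rpow_le_rpow (lintegral_mono_ae ?_) (by positivity)
  filter_upwards [h] with p hp
  exact ENNReal.rpow_le_rpow hp (by linarith)

theorem iglsENorm_rpow (hQ : 1 ≤ Q) (f : T → ℝ) :
    iglsENorm Q a b ν μ f ^ Q = ∫⁻ p in Icc a b, eLpNorm f p μ ^ Q ∂ν := by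
  rw [iglsENorm, ← ENNReal.rpow_mul, one_div_mul_cancel (by linarith), ENNReal.rpow_one]

/-- Hölder gives `|f|_1 ≤ μ(T)^(1 - 1/p) |f|_p`, and `max 1 (μ univ)` bounds the factor for all `p ≥
1` at once. The product form keeps the case `ν([a, b]) = ∞` meaningful. -/
theorem eLpNorm_one_mul_le_iglsENorm (hQ : 1 ≤ Q) (ha : 1 ≤ a) [IsFiniteMeasure μ] {f : T → ℝ}
    (hf : AEStronglyMeasurable f μ) :
    eLpNorm f 1 μ * ν (Icc a b) ^ (1 / Q) ≤ max 1 (μ univ) * iglsENorm Q a b ν μ f := by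
  have h0 : 0 < Q := by linarith
  set M := max 1 (μ univ) with hM
  have hMtop : M ≠ ∞ := by simp [hM]
  rw [← ENNReal.rpow_le_rpow_iff h0, ENNReal.mul_rpow_of_nonneg _ _ h0.le,
    ENNReal.mul_rpow_of_nonneg _ _ h0.le, iglsENorm_rpow hQ, ← ENNReal.rpow_mul,
    one_div_mul_cancel h0.ne', ENNReal.rpow_one,
    ← lintegral_const_mul' _ _ (ENNReal.rpow_ne_top_of_nonneg h0.le hMtop), ← setLIntegral_const]
  refine setLIntegral_mono' measurableSet_Icc fun p hp => ?_
  rw [← ENNReal.mul_rpow_of_nonneg _ _ h0.le]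
  refine ENNReal.rpow_le_rpow ?_ h0.le
  have hp1 : 1 ≤ p := ha.trans hp.1
  refine (eLpNorm_le_eLpNorm_mul_rpow_measure_univ hp1 hf).trans ?_
  rw [mul_comm]
  gcongr
  have hle : 1 / p.toReal ≤ 1 := by
    rcases eq_or_ne p ∞ with rfl | hpt
    · simp
    have : 1 ≤ p.toReal := by simpa using ENNReal.toReal_mono hpt hp1
    exact (div_le_one (by linarith)).2 this
  calc μ univ ^ (1 / (1 : ℝ≥0∞).toReal - 1 / p.toReal)
      ≤ M ^ (1 / (1 : ℝ≥0∞).toReal - 1 / p.toReal) :=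
        ENNReal.rpow_le_rpow (le_max_right _ _) (by simpa using hle)
    _ ≤ M ^ (1 : ℝ) := ENNReal.rpow_le_rpow_of_exponent_le (le_max_left _ _) (by simp)
    _ = M := ENNReal.rpow_one _

/-- The integral grand Lebesgue norm controls the `L¹` norm. -/
theorem exists_eLpNorm_one_le_mul_iglsENorm (hQ : 1 ≤ Q) (ha : 1 ≤ a) [IsFiniteMeasure μ]
    [NeZero (ν.restrict (Icc a b))] :
    ∃ K : NNReal, ∀ f : T → ℝ, AEStronglyMeasurable f μ → iglsENorm Q a b ν μ f ≠ ∞ →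
      eLpNorm f 1 μ ≤ K * iglsENorm Q a b ν μ f := by
  have h0 : 0 < Q := by linarith
  have hν : ν (Icc a b) ^ (1 / Q) ≠ 0 := by
    have : ν (Icc a b) ≠ 0 := by
      rw [Ne, ← Measure.restrict_eq_zero]; exact NeZero.ne _
    simp [ENNReal.rpow_eq_zero_iff, this, h0.le]
  -- If `ν([a, b]) = ∞`, this quotient is 0.
  have hK : max 1 (μ univ) / ν (Icc a b) ^ (1 / Q) ≠ ∞ :=
    ENNReal.div_ne_top (by simp) hν
  lift max 1 (μ univ) / ν (Icc a b) ^ (1 / Q) to NNReal using hK with K hKeq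
  refine ⟨K, fun f hf hfin => ?_⟩
  rw [hKeq, mul_comm, ← mul_div_assoc, mul_comm, ENNReal.le_div_iff_mul_le (Or.inl hν)
    (Or.inr (ENNReal.mul_ne_top (by simp) hfin))]
  exact eLpNorm_one_mul_le_iglsENorm hQ ha hf

/-- Lower semicontinuity of the integral grand Lebesgue norm under convergence almost
everywhere. -/
theorem iglsENorm_le_of_tendsto_ae (hQ : 1 ≤ Q) [SFinite μ] {f : ℕ → T → ℝ} {g : T → ℝ}
    (hf : ∀ n, AEStronglyMeasurable (f n) μ)
    (hlim : ∀ᵐ t ∂μ, Tendsto (fun n => f n t) atTop (𝓝 (g t))) {C : ℝ≥0∞}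
    (hC : ∀ᶠ n in atTop, iglsENorm Q a b ν μ (f n) ≤ C) : iglsENorm Q a b ν μ g ≤ C := by
  have h0 : 0 < Q := by linarith
  rw [← ENNReal.rpow_le_rpow_iff h0, iglsENorm_rpow hQ]
  calc ∫⁻ p in Icc a b, eLpNorm g p μ ^ Q ∂ν
      ≤ ∫⁻ p in Icc a b, liminf (fun n => eLpNorm (f n) p μ ^ Q) atTop ∂ν := by
        refine lintegral_mono fun p => ?_
        -- The power `Q` is an order isomorphism of `[0, ∞]`, so it commutes with the liminf; Fatou
        -- is used once in `L_p` and once for `ν`.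
        have h := (ENNReal.orderIsoRpow Q h0).liminf_apply
          (f := atTop) (u := fun n => eLpNorm (f n) p μ)
        simp only [ENNReal.orderIsoRpow_apply] at h
        rw [← h]
        exact ENNReal.rpow_le_rpow (Lp.eLpNorm_lim_le_liminf_eLpNorm hf g hlim) h0.le
    _ ≤ liminf (fun n => ∫⁻ p in Icc a b, eLpNorm (f n) p μ ^ Q ∂ν) atTop :=
        lintegral_liminf_le fun n => (measurable_eLpNorm_exponent (hf n)).pow_const Q
    _ ≤ C ^ Q := by
        refine liminf_le_of_frequently_le' (Eventually.frequently ?_)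
        filter_upwards [hC] with n hn
        rw [← iglsENorm_rpow hQ]
        exact ENNReal.rpow_le_rpow hn h0.le

end Bounds

/-! ### Completeness -/

section Complete

variable {T : Type*} [MeasurableSpace T] {Q : ℝ} [hQ : Fact (1 ≤ Q)] {a b : ℝ≥0∞}
  [ha : Fact (1 ≤ a)] {ν : Measure ℝ≥0∞} {μ : Measure T} [NeZero (ν.restrict (Icc a b))]

theorem IGLS.enorm_def [SFinite μ] (f : IGLS Q a b ν μ) :
    ‖f‖ₑ = iglsENorm Q a b ν μ (f : T →ₘ[μ] ℝ) := by
  rw [← ofReal_norm, IGLS.norm_def, ENNReal.ofReal_toReal f.2.ne]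

theorem IGLS.edist_def [SFinite μ] (f g : IGLS Q a b ν μ) :
    edist f g = iglsENorm Q a b ν μ (fun t => (f : T →ₘ[μ] ℝ) t - (g : T →ₘ[μ] ℝ) t) := by
  rw [edist_eq_enorm_sub, IGLS.enorm_def]
  exact iglsENorm_congr_ae (AEEqFun.coeFn_sub _ _)

/-- A Cauchy sequence is Cauchy in `L¹`, so a subsequence `u (φ k)` converges almost everywhere.
Lower semicontinuity along `u n - u (φ k)`, `k → ∞`, upgrades this to convergence in norm. -/
instance IGLS.instCompleteSpace [IsFiniteMeasure μ] : CompleteSpace (IGLS Q a b ν μ) := by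
  obtain ⟨K, hK⟩ := exists_eLpNorm_one_le_mul_iglsENorm (μ := μ) (ν := ν) (b := b) hQ.out ha.out
  have hmem (f : IGLS Q a b ν μ) : MemLp (f : T →ₘ[μ] ℝ) 1 μ :=
    ⟨AEEqFun.aestronglyMeasurable _, (hK _ (AEEqFun.aestronglyMeasurable _) f.2.ne).trans_lt
      (ENNReal.mul_lt_top ENNReal.coe_lt_top f.2)⟩
  have hlip : LipschitzWith K fun f : IGLS Q a b ν μ => (hmem f).toLp _ := by
    intro f g
    rw [Lp.edist_toLp_toLp, IGLS.edist_def]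
    refine hK _ ((AEEqFun.aestronglyMeasurable _).sub (AEEqFun.aestronglyMeasurable _)) ?_
    exact (IGLS.edist_def f g).symm.trans_ne (edist_ne_top _ _)
  refine EMetric.complete_of_cauchySeq_tendsto fun u hu => ?_
  obtain ⟨v, hv⟩ := cauchySeq_tendsto_of_complete (hlip.uniformContinuous.comp_cauchySeq hu)
  obtain ⟨φ, hφ, hlim⟩ := (tendstoInMeasure_of_tendsto_Lp hv).exists_seq_tendsto_ae
  have hlim' : ∀ᵐ t ∂μ, Tendsto (fun k => (u (φ k) : T →ₘ[μ] ℝ) t) atTop (𝓝 (v t)) := by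
    have hall : ∀ᵐ t ∂μ, ∀ n, (hmem (u n)).toLp _ t = (u n : T →ₘ[μ] ℝ) t :=
      ae_all_iff.2 fun n => (hmem (u n)).coeFn_toLp
    filter_upwards [hlim, hall] with t ht hn
    simpa only [Function.comp_apply, hn] using ht
  have hbound : ∀ ε > 0, ∃ N, ∀ n ≥ N,
      iglsENorm Q a b ν μ (fun t => (u n : T →ₘ[μ] ℝ) t - v t) ≤ ε := by
    intro ε hε
    obtain ⟨N, hN⟩ := EMetric.cauchySeq_iff.1 hu ε hε
    refine ⟨N, fun n hn => iglsENorm_le_of_tendsto_ae hQ.out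
      (f := fun k t => (u n : T →ₘ[μ] ℝ) t - (u (φ k) : T →ₘ[μ] ℝ) t)
      (fun k => (AEEqFun.aestronglyMeasurable _).sub (AEEqFun.aestronglyMeasurable _)) ?_ ?_⟩
    · filter_upwards [hlim'] with t ht
      exact tendsto_const_nhds.sub ht
    · filter_upwards [hφ.tendsto_atTop.eventually_ge_atTop N] with k hk
      rw [← IGLS.edist_def]
      exact (hN n hn _ hk).le
  have hv_mem : (v : T →ₘ[μ] ℝ) ∈ IGLS Q a b ν μ := by
    obtain ⟨N, hN⟩ := hbound 1 one_pos
    have h1 : iglsENorm Q a b ν μ v ≤ iglsENorm Q a b ν μ (u N : T →ₘ[μ] ℝ) +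
        iglsENorm Q a b ν μ (-fun t => (u N : T →ₘ[μ] ℝ) t - v t) := by
      have h2 := iglsENorm_add_le (Q := Q) (a := a) (b := b) (ν := ν) (μ := μ)
        hQ.out ha.out (AEEqFun.aestronglyMeasurable (u N : T →ₘ[μ] ℝ))
        (g := -fun t => (u N : T →ₘ[μ] ℝ) t - v t)
        ((AEEqFun.aestronglyMeasurable _).sub (Lp.aestronglyMeasurable v)).neg
      convert h2 using 2
      ext t
      simp
    refine h1.trans_lt (ENNReal.add_lt_top.2 ⟨(u N).2, ?_⟩)
    rw [iglsENorm_neg]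
    exact (hN N le_rfl).trans_lt ENNReal.one_lt_top
  refine ⟨⟨v, hv_mem⟩, EMetric.tendsto_atTop.2 fun ε hε => ?_⟩
  obtain ⟨δ, hδ, hδε⟩ := exists_between hε
  obtain ⟨N, hN⟩ := hbound δ hδ
  refine ⟨N, fun n hn => ?_⟩
  rw [IGLS.edist_def]
  exact (hN n hn).trans_lt hδε

end Complete

/-! ### Translations and differences -/

section Translation

variable {T : Type*} [AddGroup T] [MeasurableSpace T] [MeasurableAdd T] {Q : ℝ}
  {a b : ℝ≥0∞} {ν : Measure ℝ≥0∞} {μ : Measure T} [μ.IsAddRightInvariant]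

theorem eLpNorm_comp_add_right {f : T → ℝ} (hf : AEStronglyMeasurable f μ) (h : T) (p : ℝ≥0∞) :
    eLpNorm (fun t => f (t + h)) p μ = eLpNorm f p μ :=
  eLpNorm_comp_measurePreserving hf (measurePreserving_add_right μ h)

theorem aestronglyMeasurable_comp_add_right {f : T → ℝ} (hf : AEStronglyMeasurable f μ) (h : T) :
    AEStronglyMeasurable (fun t => f (t + h)) μ :=
  hf.comp_measurePreserving (measurePreserving_add_right μ h)

theorem aestronglyMeasurable_diffOp {f : T → ℝ} (hf : AEStronglyMeasurable f μ) (h : T) :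
    AEStronglyMeasurable (diffOp h f) μ :=
  (aestronglyMeasurable_comp_add_right hf h).sub hf

theorem eLpNorm_diffOp_le {f : T → ℝ} (hf : AEStronglyMeasurable f μ) (h : T) {p : ℝ≥0∞}
    (hp : 1 ≤ p) : eLpNorm (diffOp h f) p μ ≤ 2 * eLpNorm f p μ := by
  refine (eLpNorm_sub_le (aestronglyMeasurable_comp_add_right hf h) hf hp).trans_eq ?_
  rw [eLpNorm_comp_add_right hf, two_mul]

theorem iglsENorm_diffOp_le (hQ : 1 ≤ Q) (ha : 1 ≤ a) {f : T → ℝ}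
    (hf : AEStronglyMeasurable f μ) (h : T) :
    iglsENorm Q a b ν μ (diffOp h f) ≤ 2 * iglsENorm Q a b ν μ f := by
  have h2 : (2 : ℝ≥0∞) = ‖(2 : ℝ)‖ₑ := by
    rw [Real.enorm_eq_ofReal (by norm_num)]; simp
  rw [h2, ← iglsENorm_const_smul hQ]
  refine iglsENorm_mono hQ ?_
  filter_upwards [ae_restrict_mem measurableSet_Icc] with p hp
  rw [eLpNorm_const_smul, ← h2]
  exact eLpNorm_diffOp_le hf h (ha.trans hp.1)

/-- The modulus of continuity is stable under perturbation. -/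
theorem iglsENorm_diffOp_le_add [SFinite μ] (hQ : 1 ≤ Q) (ha : 1 ≤ a) {f g : T → ℝ}
    (hf : AEStronglyMeasurable f μ) (hg : AEStronglyMeasurable g μ) (h : T) :
    iglsENorm Q a b ν μ (diffOp h f) ≤
      iglsENorm Q a b ν μ (diffOp h g) + 2 * iglsENorm Q a b ν μ (fun t => f t - g t) := by
  have heq : diffOp h f = diffOp h g + diffOp h fun t => f t - g t := by
    ext t
    simp only [diffOp, Pi.add_apply]
    ring
  rw [heq]
  refine (iglsENorm_add_le hQ ha (aestronglyMeasurable_diffOp hg h)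
    (aestronglyMeasurable_diffOp (hf.sub hg) h)).trans ?_
  gcongr
  exact iglsENorm_diffOp_le hQ ha (hf.sub hg) h

end Translation


/-! ### Continuity of translation -/

section ContinuityOfTranslation

variable {T : Type*} [MetricSpace T] [CompactSpace T] [AddGroup T] [IsTopologicalAddGroup T]
  [MeasurableSpace T] [BorelSpace T] {μ : Measure T} [IsFiniteMeasure μ] [μ.IsAddRightInvariant]

theorem tendsto_eLpNorm_diffOp_of_continuous (g : C(T, ℝ)) (p : ℝ≥0∞) :
    Tendsto (fun h : T => eLpNorm (diffOp h g) p μ) (𝓝 0) (𝓝 0) := by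
  -- Continuity of the curried map for the sup norm expresses the uniform continuity of `g`.
  let κ : C(T, C(T, ℝ)) := ContinuousMap.curry ⟨fun z : T × T => g (z.2 + z.1), by fun_prop⟩
  have hκ (h t : T) : κ h t = g (t + h) := rfl
  have hle (h : T) : eLpNorm (diffOp h g) p μ ≤
      μ univ ^ p.toReal⁻¹ * ENNReal.ofReal (dist (κ h) (κ 0)) := by
    refine eLpNorm_le_of_ae_bound (ae_of_all _ fun t => ?_)
    have := ContinuousMap.dist_apply_le_dist (f := κ h) (g := κ 0) t
    rwa [hκ, hκ, add_zero, Real.dist_eq] at this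
  have hlim : Tendsto (fun h => μ univ ^ p.toReal⁻¹ * ENNReal.ofReal (dist (κ h) (κ 0)))
      (𝓝 0) (𝓝 0) := by
    have h1 : Tendsto (fun h => dist (κ h) (κ 0)) (𝓝 0) (𝓝 0) :=
      tendsto_iff_dist_tendsto_zero.1 (κ.continuous.tendsto 0)
    have h2 := ENNReal.Tendsto.const_mul (a := μ univ ^ p.toReal⁻¹)
      (ENNReal.tendsto_ofReal h1)
      (Or.inr (ENNReal.rpow_ne_top_of_nonneg (by positivity) (measure_ne_top μ univ)))
    simpa using h2
  exact tendsto_of_tendsto_of_tendsto_of_le_of_le tendsto_const_nhds hlim (fun _ => zero_le) hle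

/-- Translation is continuous in `Lᵖ` for finite `p`. -/
theorem tendsto_eLpNorm_diffOp {p : ℝ≥0∞} (hp1 : 1 ≤ p) (hp : p ≠ ∞) {f : T → ℝ}
    (hf : MemLp f p μ) :
    Tendsto (fun h : T => eLpNorm (diffOp h f) p μ) (𝓝 0) (𝓝 0) := by
  refine ENNReal.tendsto_nhds_zero.2 fun ε hε => ?_
  have hε3 : ε / 3 ≠ 0 := (ENNReal.div_pos hε.ne' (by simp)).ne'
  obtain ⟨g, hfg, hg⟩ := hf.exists_boundedContinuous_eLpNorm_sub_le hp hε3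
  filter_upwards [ENNReal.tendsto_nhds_zero.1
    (tendsto_eLpNorm_diffOp_of_continuous (μ := μ) g.toContinuousMap p) (ε / 3) hε3.bot_lt]
    with h hh
  have heq : diffOp h f = diffOp h (f - ⇑g) + diffOp h g := by
    ext t
    simp only [diffOp, Pi.add_apply, Pi.sub_apply]
    ring
  have hm : AEStronglyMeasurable (f - ⇑g) μ := hf.1.sub hg.1
  calc eLpNorm (diffOp h f) p μ
      ≤ eLpNorm (diffOp h (f - ⇑g)) p μ + eLpNorm (diffOp h g) p μ := by
        rw [heq]
        exact eLpNorm_add_le (aestronglyMeasurable_diffOp hm h)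
          (aestronglyMeasurable_diffOp hg.1 h) hp1
    _ ≤ 2 * (ε / 3) + ε / 3 := by
        gcongr
        · exact (eLpNorm_diffOp_le hm h hp1).trans (by gcongr)
        · exact hh
    _ = ε / 3 + ε / 3 + ε / 3 := by rw [two_mul]
    _ = ε := ENNReal.add_thirds ε

variable {Q : ℝ} {a b : ℝ≥0∞} {ν : Measure ℝ≥0∞}

/-- Translation is continuous in the integral grand Lebesgue space. -/
theorem tendsto_iglsENorm_diffOp (hQ : 1 ≤ Q) (ha : 1 ≤ a) (hν : b < ∞ ∨ ν {∞} = 0) {f : T → ℝ}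
    (hf : AEStronglyMeasurable f μ) (hfin : iglsENorm Q a b ν μ f ≠ ∞) :
    Tendsto (fun h : T => iglsENorm Q a b ν μ (diffOp h f)) (𝓝 0) (𝓝 0) := by
  have h0 : 0 < Q := by linarith
  have hint : ∫⁻ p in Icc a b, eLpNorm f p μ ^ Q ∂ν ≠ ∞ := by
    rw [← iglsENorm_rpow hQ]
    exact ENNReal.rpow_ne_top_of_nonneg h0.le hfin
  have hmeas := (measurable_eLpNorm_exponent hf).pow_const Q
  have hlim : Tendsto (fun h : T => ∫⁻ p in Icc a b, eLpNorm (diffOp h f) p μ ^ Q ∂ν) (𝓝 0)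
      (𝓝 (∫⁻ _ in Icc a b, 0 ∂ν)) := by
    -- The dominating function comes from `|Θ_h f|_p ≤ 2 |f|_p`.
    refine tendsto_lintegral_filter_of_dominated_convergence
      (fun p => 2 ^ Q * eLpNorm f p μ ^ Q) ?_ ?_ ?_ ?_
    · exact Eventually.of_forall fun h =>
        (measurable_eLpNorm_exponent (aestronglyMeasurable_diffOp hf h)).pow_const Q
    · refine Eventually.of_forall fun h => ?_
      filter_upwards [ae_restrict_mem measurableSet_Icc] with p hp
      rw [← ENNReal.mul_rpow_of_nonneg _ _ h0.le]
      exact ENNReal.rpow_le_rpow (eLpNorm_diffOp_le hf h (ha.trans hp.1)) h0.le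
    · have h2 : (2 : ℝ≥0∞) ^ Q ≠ ∞ := ENNReal.rpow_ne_top_of_nonneg h0.le (by simp)
      rw [lintegral_const_mul' _ _ h2]
      exact ENNReal.mul_ne_top h2 hint
    · filter_upwards [ae_restrict_Icc_ne_top hν, ae_lt_top hmeas hint] with p hp hpfin
      have hmem : MemLp f p μ := ⟨hf, by
        by_contra h
        rw [not_lt, top_le_iff] at h
        simp [h, h0] at hpfin⟩
      have h := (tendsto_eLpNorm_diffOp (ha.trans hp.1.1) hp.2 hmem).ennrpow_const Q
      rwa [ENNReal.zero_rpow_of_pos h0] at h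
  rw [lintegral_zero] at hlim
  have h := hlim.ennrpow_const (1 / Q)
  rwa [ENNReal.zero_rpow_of_pos (by positivity)] at h

end ContinuityOfTranslation

/-! ### Averages over translations and Arzelà–Ascoli -/

section Averaging

variable {T : Type*} [MetricSpace T] [CompactSpace T] [AddGroup T] [IsTopologicalAddGroup T]
  [MeasurableSpace T] [BorelSpace T] {μ : Measure T} [IsFiniteMeasure μ]

/-- The average of the right translates of `f` with continuous weight `φ`. -/
noncomputable def translationAverage (μ : Measure T) (φ : C(T, ℝ)) (f : T → ℝ) (t : T) : ℝ :=
  ∫ h, φ h * f (t + h) ∂μ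

/-- The left translates of a continuous function. -/
def leftTranslates (φ : C(T, ℝ)) : C(T, C(T, ℝ)) :=
  ContinuousMap.curry ⟨fun z : T × T => φ (-z.1 + z.2), by fun_prop⟩

theorem leftTranslates_apply (φ : C(T, ℝ)) (t s : T) : leftTranslates φ t s = φ (-t + s) := rfl

/-- Left invariance moves `t` from `f`, which may be merely integrable, to the continuous weight;
the regularity of the average comes from there. -/
theorem translationAverage_eq [μ.IsAddLeftInvariant] (φ : C(T, ℝ)) (f : T → ℝ) (t : T) :
    translationAverage μ φ f t = ∫ s, leftTranslates φ t s * f s ∂μ := by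
  rw [translationAverage, ← integral_add_left_eq_self (fun s => leftTranslates φ t s * f s) t]
  simp [leftTranslates_apply]

theorem integrable_continuousMap_mul (ψ : C(T, ℝ)) {f : T → ℝ} (hf : Integrable f μ) :
    Integrable (fun s => ψ s * f s) μ :=
  hf.bdd_mul (c := ‖ψ‖) ψ.continuous.aestronglyMeasurable (ae_of_all _ ψ.norm_coe_le_norm)

theorem norm_integral_continuousMap_mul_le (ψ : C(T, ℝ)) {f : T → ℝ} (hf : Integrable f μ) :
    ‖∫ s, ψ s * f s ∂μ‖ ≤ ‖ψ‖ * ∫ s, ‖f s‖ ∂μ := by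
  rw [← integral_const_mul]
  refine norm_integral_le_of_norm_le (hf.norm.const_mul _) (ae_of_all _ fun s => ?_)
  rw [norm_mul]
  gcongr
  exact ψ.norm_coe_le_norm s

theorem norm_translationAverage_le [μ.IsAddLeftInvariant] (φ : C(T, ℝ)) {f : T → ℝ}
    (hf : Integrable f μ) (t : T) :
    ‖translationAverage μ φ f t‖ ≤ ‖φ‖ * ∫ s, ‖f s‖ ∂μ := by
  rw [translationAverage_eq]
  refine (norm_integral_continuousMap_mul_le (leftTranslates φ t) hf).trans ?_
  gcongr
  exact (ContinuousMap.norm_le _ (norm_nonneg _)).2 fun s => φ.norm_coe_le_norm _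

theorem dist_translationAverage_le [μ.IsAddLeftInvariant] (φ : C(T, ℝ)) {f : T → ℝ}
    (hf : Integrable f μ) (t t' : T) :
    dist (translationAverage μ φ f t) (translationAverage μ φ f t') ≤
      dist (leftTranslates φ t) (leftTranslates φ t') * ∫ s, ‖f s‖ ∂μ := by
  rw [dist_eq_norm, dist_eq_norm, translationAverage_eq, translationAverage_eq,
    ← integral_sub (integrable_continuousMap_mul (leftTranslates φ t) hf)
      (integrable_continuousMap_mul (leftTranslates φ t') hf)]
  refine le_of_eq_of_le ?_ (norm_integral_continuousMap_mul_le _ hf)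
  congr 2
  ext s
  simp only [ContinuousMap.sub_apply, sub_mul]

theorem continuous_translationAverage [μ.IsAddLeftInvariant] (φ : C(T, ℝ)) {f : T → ℝ}
    (hf : Integrable f μ) : Continuous (translationAverage μ φ f) := by
  refine continuous_iff_continuousAt.2 fun t => tendsto_iff_dist_tendsto_zero.2 ?_
  refine squeeze_zero (fun _ => dist_nonneg)
    (fun t' => dist_translationAverage_le φ hf t' t) ?_
  have h := (tendsto_iff_dist_tendsto_zero.1
    ((leftTranslates φ).continuous.tendsto t)).mul_const (∫ s, ‖f s‖ ∂μ)
  simpa using h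

/-- The averages of the functions of an `L¹`-bounded set form a relatively compact set of
continuous functions. -/
theorem isCompact_closure_translationAverage [μ.IsAddLeftInvariant] (φ : C(T, ℝ)) (C : ℝ) :
    IsCompact (closure {u : BoundedContinuousFunction T ℝ | ∃ f : T → ℝ, Integrable f μ ∧
      ∫ s, ‖f s‖ ∂μ ≤ C ∧ ⇑u = translationAverage μ φ f}) := by
  refine BoundedContinuousFunction.arzela_ascoli (Metric.closedBall 0 (‖φ‖ * C))
    (isCompact_closedBall _ _) _ ?_ ?_
  · rintro u t ⟨f, hf, hC, hu⟩
    rw [mem_closedBall_zero_iff, hu]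
    exact (norm_translationAverage_le φ hf t).trans (by gcongr)
  · intro t
    refine Metric.equicontinuousAt_of_continuity_modulus
      (fun t' => dist (leftTranslates φ t) (leftTranslates φ t') * C) ?_ _ ?_
    · have h := (tendsto_iff_dist_tendsto_zero.1
        ((leftTranslates φ).continuous.tendsto t)).mul_const C
      simpa [dist_comm] using h
    · refine Eventually.of_forall fun t' => ?_
      rintro ⟨u, f, hf, hC, hu⟩
      simp only [hu]
      exact (dist_translationAverage_le φ hf t t').trans (by gcongr)

end Averaging

/-! ### Distance from a function to its average -/

section AveragingEstimate

variable {T : Type*} [MetricSpace T] [CompactSpace T] [AddGroup T] [IsTopologicalAddGroup T]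
  [MeasurableSpace T] [BorelSpace T] {μ : Measure T} [IsFiniteMeasure μ]

theorem exists_continuousMap_integral_eq_one [μ.IsOpenPosMeasure] {r : ℝ} (hr : 0 < r) :
    ∃ φ : C(T, ℝ), (∀ h, 0 ≤ φ h) ∧ ∫ h, φ h ∂μ = 1 ∧ ∀ h, φ h ≠ 0 → dist h 0 < r := by
  let ψ : C(T, ℝ) := ⟨fun h => max 0 (r - dist h 0), by fun_prop⟩
  have hψ (h : T) : ψ h = max 0 (r - dist h 0) := rfl
  have hψ0 (h : T) : 0 ≤ ψ h := le_max_left _ _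
  have hpos : 0 < ∫ h, ψ h ∂μ := by
    refine ψ.continuous.integral_pos_of_hasCompactSupport_nonneg_nonzero
      (HasCompactSupport.of_compactSpace _) hψ0 (x := 0) ?_
    simp [hψ, hr.ne', hr.le]
  refine ⟨(∫ h, ψ h ∂μ)⁻¹ • ψ, fun h => ?_, ?_, fun h hh => ?_⟩
  · exact mul_nonneg (by positivity) (hψ0 h)
  · simp only [ContinuousMap.smul_apply, smul_eq_mul, integral_const_mul]
    exact inv_mul_cancel₀ hpos.ne'
  · by_contra hd
    refine hh ?_
    rw [ContinuousMap.smul_apply, hψ, max_eq_left (by linarith), smul_zero]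

variable [μ.IsAddLeftInvariant] [μ.IsAddRightInvariant] {φ : C(T, ℝ)}

/-- As `φ` has integral 1, `f(t)` is the average of a constant, and the difference is the average of
`Θ_h f(t)`. -/
theorem enorm_translationAverage_sub_le (hφ : ∀ h, 0 ≤ φ h) (hφ1 : ∫ h, φ h ∂μ = 1) {f : T → ℝ}
    (hfm : Measurable f) (hf : Integrable f μ) (t : T) :
    ‖translationAverage μ φ f t - f t‖ₑ ≤
      ∫⁻ h, ‖diffOp h f t‖ₑ ∂μ.withDensity fun h => ENNReal.ofReal (φ h) := by
  have h1 : translationAverage μ φ f t - f t = ∫ h, φ h * diffOp h f t ∂μ := by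
    simp only [diffOp, mul_sub]
    rw [integral_sub (integrable_continuousMap_mul φ (hf.comp_add_left t))
      (integrable_continuousMap_mul φ (integrable_const _)), integral_mul_const, hφ1, one_mul]
    rfl
  rw [h1, lintegral_withDensity_eq_lintegral_mul _ (by fun_prop)
    (by unfold diffOp; fun_prop)]
  refine (enorm_integral_le_lintegral_enorm _).trans_eq (lintegral_congr fun h => ?_)
  rw [enorm_mul, Real.enorm_eq_ofReal (hφ h), Pi.mul_apply]

theorem isProbabilityMeasure_withDensity (hφ : ∀ h, 0 ≤ φ h) (hφ1 : ∫ h, φ h ∂μ = 1) :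
    IsProbabilityMeasure (μ.withDensity fun h => ENNReal.ofReal (φ h)) := by
  refine ⟨?_⟩
  rw [withDensity_apply _ MeasurableSet.univ, setLIntegral_univ,
    ← ofReal_integral_eq_lintegral_ofReal _ (ae_of_all _ hφ), hφ1, ENNReal.ofReal_one]
  simpa using integrable_continuousMap_mul φ (integrable_const (1 : ℝ))

theorem eLpNorm_translationAverage_sub_le (hφ : ∀ h, 0 ≤ φ h) (hφ1 : ∫ h, φ h ∂μ = 1)
    {f : T → ℝ} (hfm : Measurable f) (hf : Integrable f μ) {p : ℝ≥0∞} (hp1 : 1 ≤ p) (hp : p ≠ ∞)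
    (hfp : eLpNorm f p μ ≠ ∞) :
    eLpNorm (translationAverage μ φ f - f) p μ ≤
      ∫⁻ h, eLpNorm (diffOp h f) p μ ∂μ.withDensity fun h => ENNReal.ofReal (φ h) := by
  have := isProbabilityMeasure_withDensity hφ hφ1
  have hp0 : p ≠ 0 := (zero_lt_one.trans_le hp1).ne'
  have hpr : 1 ≤ p.toReal := by simpa using ENNReal.toReal_mono hp hp1
  simp only [eLpNorm_eq_lintegral_rpow_enorm_toReal hp0 hp]
  -- The uniform bound required by Minkowski's inequality is `|Θ_h f|_p ≤ 2 |f|_p`.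
  refine le_trans ?_ (rpow_lintegral_rpow_lintegral_le μ _ (g := fun t h => ‖diffOp h f t‖ₑ)
    (by unfold diffOp; simp only [Function.uncurry_def]; fun_prop) hpr
    (C := (2 * eLpNorm f p μ) ^ p.toReal) ?_ fun h => ?_)
  · refine ENNReal.rpow_le_rpow (lintegral_mono fun t => ?_) (by positivity)
    exact ENNReal.rpow_le_rpow (enorm_translationAverage_sub_le hφ hφ1 hfm hf t) (by positivity)
  · exact ENNReal.rpow_ne_top_of_nonneg (by positivity) (ENNReal.mul_ne_top (by simp) hfp)
  · have h1 := ENNReal.rpow_le_rpow (eLpNorm_diffOp_le hfm.aestronglyMeasurable h hp1 (μ := μ))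
      (zero_le_one.trans hpr)
    rwa [eLpNorm_eq_lintegral_rpow_enorm_toReal hp0 hp, ← ENNReal.rpow_mul,
      one_div_mul_cancel (by linarith), ENNReal.rpow_one] at h1

variable {Q : ℝ} {a b : ℝ≥0∞} {ν : Measure ℝ≥0∞} [SFinite ν]

/-- Averaging over small translations is close to the identity, in terms of the modulus of
continuity. -/
theorem iglsENorm_translationAverage_sub_le (hQ : 1 ≤ Q) (ha : 1 ≤ a)
    (hν : b < ∞ ∨ ν {∞} = 0) (hφ : ∀ h, 0 ≤ φ h) (hφ1 : ∫ h, φ h ∂μ = 1)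
    {f : T → ℝ} (hfm : Measurable f) (hf : Integrable f μ)
    (hfin : iglsENorm Q a b ν μ f ≠ ∞) {S : ℝ≥0∞}
    (hS : ∀ h, φ h ≠ 0 → iglsENorm Q a b ν μ (diffOp h f) ≤ S) :
    iglsENorm Q a b ν μ (translationAverage μ φ f - f) ≤ S := by
  have h0 : 0 < Q := by linarith
  have := isProbabilityMeasure_withDensity hφ hφ1
  set m := μ.withDensity fun h => ENNReal.ofReal (φ h) with hm
  have hint : ∫⁻ p in Icc a b, eLpNorm f p μ ^ Q ∂ν ≠ ∞ := by
    rw [← iglsENorm_rpow hQ]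
    exact ENNReal.rpow_ne_top_of_nonneg h0.le hfin
  -- For finite `p ≥ 1` this is `|Θ_h f|_p`, in a form whose joint measurability in `(p, h)`, needed
  -- for Tonelli, is visible.
  let N (p : ℝ≥0∞) (h : T) : ℝ≥0∞ := (∫⁻ t, ‖diffOp h f t‖ₑ ^ p.toReal ∂μ) ^ (1 / p.toReal)
  have hN {p : ℝ≥0∞} (hp1 : 1 ≤ p) (hp : p ≠ ∞) (h : T) : eLpNorm (diffOp h f) p μ = N p h :=
    eLpNorm_eq_lintegral_rpow_enorm_toReal (zero_lt_one.trans_le hp1).ne' hp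
  have hNm : Measurable (Function.uncurry N) := by
    refine Measurable.pow ?_ (by fun_prop)
    refine Measurable.lintegral_prod_right'
      (f := fun z : (ℝ≥0∞ × T) × T => ‖diffOp z.1.2 f z.2‖ₑ ^ z.1.1.toReal) ?_
    unfold diffOp
    fun_prop
  rw [← ENNReal.rpow_le_rpow_iff h0, iglsENorm_rpow hQ]
  calc ∫⁻ p in Icc a b, eLpNorm (translationAverage μ φ f - f) p μ ^ Q ∂ν
      ≤ ∫⁻ p in Icc a b, ∫⁻ h, N p h ^ Q ∂m ∂ν := by
        refine lintegral_mono_ae ?_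
        filter_upwards [ae_restrict_Icc_ne_top hν,
          ae_lt_top ((measurable_eLpNorm_exponent hfm.aestronglyMeasurable).pow_const Q) hint]
          with p hp hpfin
        have hp1 := ha.trans hp.1.1
        have hfp : eLpNorm f p μ ≠ ∞ := by
          intro h
          simp [h, h0] at hpfin
        have h1 := eLpNorm_translationAverage_sub_le hφ hφ1 hfm hf hp1 hp.2 hfp
        simp only [hN hp1 hp.2] at h1
        exact (ENNReal.rpow_le_rpow h1 h0.le).trans (rpow_lintegral_le_lintegral_rpow m
          (hNm.comp measurable_prodMk_left).aemeasurable hQ)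
    _ = ∫⁻ h, ∫⁻ p in Icc a b, N p h ^ Q ∂ν ∂m :=
        lintegral_lintegral_swap (f := fun p h => N p h ^ Q) (hNm.pow_const Q).aemeasurable
    _ ≤ ∫⁻ _, S ^ Q ∂m := by
        refine lintegral_mono_ae ?_
        rw [hm, ae_withDensity_iff (by fun_prop)]
        refine ae_of_all _ fun h hh => ?_
        have hφh : φ h ≠ 0 := by
          intro h'
          simp [h'] at hh
        refine le_trans (lintegral_mono_ae ?_) ((iglsENorm_rpow hQ _).symm.trans_le
          (ENNReal.rpow_le_rpow (hS h hφh) h0.le))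
        filter_upwards [ae_restrict_Icc_ne_top hν] with p hp
        rw [hN (ha.trans hp.1.1) hp.2]
    _ = S ^ Q := by simp

end AveragingEstimate

/-! ### Continuous functions in the grand Lebesgue space -/

section Embedding

variable {T : Type*} [MetricSpace T] [CompactSpace T] [MeasurableSpace T] [BorelSpace T]
  {Q : ℝ} {a b : ℝ≥0∞} {ν : Measure ℝ≥0∞} {μ : Measure T} [IsFiniteMeasure μ]

/-- The norms `|1|_p` are at most `max 1 (μ univ)`, uniformly in `p ≥ 1`. -/
theorem iglsENorm_one_ne_top (hQ : 1 ≤ Q) (ha : 1 ≤ a) (hν : ν (Icc a b) ≠ ∞) :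
    iglsENorm Q a b ν μ (fun _ => 1) ≠ ∞ := by
  have h0 : 0 < Q := by linarith
  refine ENNReal.rpow_ne_top_of_nonneg (by positivity) ?_
  refine ne_top_of_le_ne_top (ENNReal.mul_ne_top (ENNReal.rpow_ne_top_of_nonneg h0.le
    (x := max 1 (μ univ)) (by simp)) hν) ((setLIntegral_mono' measurableSet_Icc fun p hp => ?_).trans_eq
    (setLIntegral_const _ _))
  refine ENNReal.rpow_le_rpow ?_ h0.le
  refine (eLpNorm_le_of_ae_bound (C := 1) (by simp)).trans ?_
  rw [ENNReal.ofReal_one, mul_one]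
  have hle : p.toReal⁻¹ ≤ 1 := by
    rcases eq_or_ne p ∞ with rfl | hpt
    · simp
    exact inv_le_one_of_one_le₀ (by simpa using ENNReal.toReal_mono hpt (ha.trans hp.1))
  calc μ univ ^ p.toReal⁻¹ ≤ max 1 (μ univ) ^ p.toReal⁻¹ :=
        ENNReal.rpow_le_rpow (le_max_right _ _) (by positivity)
    _ ≤ max 1 (μ univ) ^ (1 : ℝ) := ENNReal.rpow_le_rpow_of_exponent_le (le_max_left _ _) hle
    _ = _ := ENNReal.rpow_one _

theorem iglsENorm_boundedContinuousFunction_le (hQ : 1 ≤ Q) (u : BoundedContinuousFunction T ℝ) :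
    iglsENorm Q a b ν μ u ≤ ‖u‖ₑ * iglsENorm Q a b ν μ fun _ => 1 := by
  rw [← enorm_norm, ← iglsENorm_const_smul hQ]
  refine iglsENorm_mono hQ (ae_of_all _ fun p => eLpNorm_mono fun t => ?_)
  simpa using u.norm_coe_le_norm t

variable [hQ : Fact (1 ≤ Q)] [ha : Fact (1 ≤ a)]

/-- The inclusion of the bounded continuous functions in the integral grand Lebesgue space. -/
noncomputable def IGLS.ofBoundedContinuousFunction
    (hν : ν (Icc a b) ≠ ∞) (u : BoundedContinuousFunction T ℝ) :
    IGLS Q a b ν μ :=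
  ⟨AEEqFun.mk u u.continuous.aestronglyMeasurable, by
    change iglsENorm Q a b ν μ _ < ∞
    rw [iglsENorm_congr_ae (AEEqFun.coeFn_mk _ _)]
    exact (iglsENorm_boundedContinuousFunction_le hQ.out u).trans_lt
      (ENNReal.mul_lt_top enorm_lt_top (iglsENorm_one_ne_top hQ.out ha.out hν).lt_top)⟩

theorem IGLS.coeFn_ofBoundedContinuousFunction (hν : ν (Icc a b) ≠ ∞)
    (u : BoundedContinuousFunction T ℝ) :
    (ofBoundedContinuousFunction hν u : IGLS Q a b ν μ).1 =ᵐ[μ] u :=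
  AEEqFun.coeFn_mk _ _

variable [NeZero (ν.restrict (Icc a b))]

theorem IGLS.continuous_ofBoundedContinuousFunction (hν : ν (Icc a b) ≠ ∞) :
    Continuous (ofBoundedContinuousFunction hν : _ → IGLS Q a b ν μ) := by
  have h1 := iglsENorm_one_ne_top (μ := μ) hQ.out ha.out hν
  lift iglsENorm Q a b ν μ (fun _ => 1) to NNReal using h1 with K hK
  refine LipschitzWith.continuous (K := K) fun u v => ?_
  rw [IGLS.edist_def, edist_eq_enorm_sub, mul_comm, hK]
  refine le_of_eq_of_le (iglsENorm_congr_ae ?_)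
    (iglsENorm_boundedContinuousFunction_le hQ.out (u - v))
  filter_upwards [coeFn_ofBoundedContinuousFunction (Q := Q) (μ := μ) hν u,
    coeFn_ofBoundedContinuousFunction (Q := Q) (μ := μ) hν v] with t hu hv
  simp [hu, hv]

/-- A nonzero `L¹` norm times `ν([a, b])^(1/Q) = ∞` would exceed a finite bound. -/
theorem IGLS.subsingleton_of_measure_Icc_eq_top (hν : ν (Icc a b) = ∞) :
    Subsingleton (IGLS Q a b ν μ) := by
  have h0 : 0 < Q := one_pos.trans_le hQ.out
  refine subsingleton_of_forall_eq 0 fun f => ?_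
  have h := eLpNorm_one_mul_le_iglsENorm (b := b) (ν := ν) hQ.out ha.out
    (AEEqFun.aestronglyMeasurable (f : T →ₘ[μ] ℝ))
  have hz : eLpNorm (f : T →ₘ[μ] ℝ) 1 μ = 0 := by
    by_contra hne
    rw [hν, ENNReal.top_rpow_of_pos (by positivity), ENNReal.mul_top hne, top_le_iff] at h
    exact ENNReal.mul_ne_top (by simp) f.2.ne h
  rw [eLpNorm_eq_zero_iff (AEEqFun.aestronglyMeasurable _) one_ne_zero] at hz
  exact Subtype.ext (AEEqFun.ext (hz.trans AEEqFun.coeFn_zero.symm))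

end Embedding

/-! ### The two implications -/

section Compactness

variable {T : Type*} [MetricSpace T] [CompactSpace T] [AddGroup T] [IsTopologicalAddGroup T]
  [MeasurableSpace T] [BorelSpace T] {μ : Measure T} [IsFiniteMeasure μ] [μ.IsAddRightInvariant]
  {Q : ℝ} [hQ : Fact (1 ≤ Q)] {a b : ℝ≥0∞} [ha : Fact (1 ≤ a)] {ν : Measure ℝ≥0∞}
  [NeZero (ν.restrict (Icc a b))] {F : Set (IGLS Q a b ν μ)}

/-- Replacing `f` by a point `g` of a finite `ε/3`-net changes the norm of `Θ_h f` by at most `2⟨f -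
g⟩`. -/
theorem IGLS.tendsto_iSup_diffOp_of_isCompact (hν : b < ∞ ∨ ν {∞} = 0) (hF : IsCompact F) :
    Tendsto (fun h : T => ⨆ f ∈ F, iglsENorm Q a b ν μ (diffOp h (f : T →ₘ[μ] ℝ)))
      (𝓝 0) (𝓝 0) := by
  refine ENNReal.tendsto_nhds_zero.2 fun ε hε => ?_
  have hε3 : 0 < ε / 3 := ENNReal.div_pos hε.ne' (by simp)
  obtain ⟨s, -, hs, hFs⟩ := EMetric.totallyBounded_iff'.1 hF.totallyBounded (ε / 3) hε3
  have hev : ∀ᶠ h in 𝓝 (0 : T), ∀ g ∈ s,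
      iglsENorm Q a b ν μ (diffOp h (g : T →ₘ[μ] ℝ)) ≤ ε / 3 :=
    (eventually_all_finite hs).2 fun g _ => ENNReal.tendsto_nhds_zero.1
      (tendsto_iglsENorm_diffOp hQ.out ha.out hν (AEEqFun.aestronglyMeasurable _) g.2.ne) _ hε3
  filter_upwards [hev] with h hh
  refine iSup₂_le fun f hf => ?_
  obtain ⟨g, hg, hfg⟩ := mem_iUnion₂.1 (hFs hf)
  have hfg' : iglsENorm Q a b ν μ (fun t => (f : T →ₘ[μ] ℝ) t - (g : T →ₘ[μ] ℝ) t) ≤ ε / 3 := by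
    rw [← IGLS.edist_def]
    exact hfg.le
  calc iglsENorm Q a b ν μ (diffOp h (f : T →ₘ[μ] ℝ))
      ≤ ε / 3 + 2 * (ε / 3) :=
        (iglsENorm_diffOp_le_add hQ.out ha.out (AEEqFun.aestronglyMeasurable _)
          (AEEqFun.aestronglyMeasurable _) h).trans (by gcongr; exact hh g hg)
    _ = ε / 3 + ε / 3 + ε / 3 := by rw [two_mul, add_assoc]
    _ = ε := ENNReal.add_thirds ε

theorem IGLS.totallyBounded_of_tendsto_iSup_diffOp [μ.IsAddLeftInvariant] [μ.IsOpenPosMeasure]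
    [SFinite ν] (hν : b < ∞ ∨ ν {∞} = 0) (hbdd : Bornology.IsBounded F)
    (hF : Tendsto (fun h : T => ⨆ f ∈ F, iglsENorm Q a b ν μ (diffOp h (f : T →ₘ[μ] ℝ)))
      (𝓝 0) (𝓝 0)) : TotallyBounded F := by
  rcases eq_or_ne (ν (Icc a b)) ∞ with hνtop | hνtop
  · have := IGLS.subsingleton_of_measure_Icc_eq_top (Q := Q) (μ := μ) hνtop
    exact (Set.subsingleton_of_subsingleton (s := F)).finite.totallyBounded
  obtain ⟨K, hK⟩ := exists_eLpNorm_one_le_mul_iglsENorm (μ := μ) (ν := ν) (b := b) hQ.out ha.out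
  obtain ⟨R, hR⟩ := hbdd.exists_norm_le
  have hL1 (f : IGLS Q a b ν μ) : eLpNorm (f : T →ₘ[μ] ℝ) 1 μ ≤ K * iglsENorm Q a b ν μ f.1 :=
    hK _ (AEEqFun.aestronglyMeasurable _) f.2.ne
  have hint (f : IGLS Q a b ν μ) : Integrable (f : T →ₘ[μ] ℝ) μ :=
    memLp_one_iff_integrable.1 ⟨AEEqFun.aestronglyMeasurable _,
      (hL1 f).trans_lt (ENNReal.mul_lt_top ENNReal.coe_lt_top f.2)⟩
  have hintR {f : IGLS Q a b ν μ} (hf : f ∈ F) : ∫ t, ‖(f : T →ₘ[μ] ℝ) t‖ ∂μ ≤ K * R := by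
    have h1 := ENNReal.toReal_mono (ENNReal.mul_ne_top ENNReal.coe_ne_top f.2.ne) (hL1 f)
    rw [eLpNorm_one_eq_lintegral_enorm, ← integral_norm_eq_lintegral_enorm (hint f).1,
      ENNReal.toReal_mul, ENNReal.coe_toReal, ← IGLS.norm_def] at h1
    exact h1.trans (by gcongr; exact hR f hf)
  refine EMetric.totallyBounded_iff.2 fun ε hε => ?_
  have hε2 : 0 < ε / 2 := ENNReal.half_pos hε.ne'
  -- The modulus of continuity yields only a non-strict bound, while the net needs a strict one;
  -- hence `δ < ε / 2`.
  obtain ⟨δ, hδ, hδε⟩ := exists_between hε2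
  obtain ⟨r, hr, hrF⟩ := Metric.eventually_nhds_iff.1 (ENNReal.tendsto_nhds_zero.1 hF δ hδ)
  obtain ⟨φ, hφ, hφ1, hφr⟩ := exists_continuousMap_integral_eq_one (μ := μ) hr
  -- An `ε/2`-net of the averages for the fixed weight `φ` serves as an `ε`-net of `F`.
  obtain ⟨s, hs, hcover⟩ := EMetric.totallyBounded_iff.1
    ((isCompact_closure_translationAverage (μ := μ) φ (K * R)).image
      (IGLS.continuous_ofBoundedContinuousFunction (Q := Q) (μ := μ) hνtop)).totallyBounded
    (ε / 2) hε2
  refine ⟨s, hs, fun f hf => ?_⟩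
  let u : BoundedContinuousFunction T ℝ :=
    BoundedContinuousFunction.mkOfCompact ⟨_, continuous_translationAverage φ (hint f)⟩
  have hu : u ∈ {u : BoundedContinuousFunction T ℝ | ∃ f : T → ℝ, Integrable f μ ∧
      ∫ s, ‖f s‖ ∂μ ≤ K * R ∧ ⇑u = translationAverage μ φ f} := ⟨f, hint f, hintR hf, rfl⟩
  obtain ⟨g, hg, hug⟩ := mem_iUnion₂.1 (hcover (mem_image_of_mem _ (subset_closure hu)))
  refine mem_iUnion₂.2 ⟨g, hg, ?_⟩
  have hfu : edist f (IGLS.ofBoundedContinuousFunction hνtop u) ≤ δ := by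
    rw [edist_comm, IGLS.edist_def]
    refine le_of_eq_of_le (iglsENorm_congr_ae ?_) (iglsENorm_translationAverage_sub_le hQ.out
      ha.out hν hφ hφ1 (AEEqFun.stronglyMeasurable (f : T →ₘ[μ] ℝ)).measurable (hint f) f.2.ne
      fun h hh => ?_)
    · filter_upwards [IGLS.coeFn_ofBoundedContinuousFunction (Q := Q) (μ := μ) hνtop u] with t ht
      rw [ht]
      rfl
    · exact (le_iSup₂ (f := fun (f : IGLS Q a b ν μ) (_ : f ∈ F) =>
        iglsENorm Q a b ν μ (diffOp h (f : T →ₘ[μ] ℝ))) f hf).trans (hrF (hφr h hh))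
  calc edist f g ≤ _ := edist_triangle f (IGLS.ofBoundedContinuousFunction hνtop u) g
    _ < ε / 2 + ε / 2 := ENNReal.add_lt_add (hfu.trans_lt hδε) hug
    _ = ε := ENNReal.add_halves ε

end Compactness

theorem theorem8p3 {T : Type*} [MetricSpace T] [CompactSpace T] [AddGroup T]
    [IsTopologicalAddGroup T] [MeasurableSpace T] [BorelSpace T]
    (μ : Measure T) [SigmaFinite μ] [NeZero μ] [μ.IsAddRightInvariant]
    (Q : ℝ) [Fact (1 ≤ Q)] (a b : ℝ≥0∞) [Fact (1 ≤ a)] (_hab : a < b)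
    (ν : Measure ℝ≥0∞) [SigmaFinite ν] [NeZero (ν.restrict (Icc a b))]
    (_hν : b < ∞ ∨ ν {∞} = 0)
    (F : Set (IGLS Q a b ν μ)) :
    IsCompact F ↔ Bornology.IsBounded F ∧ IsClosed F ∧
      Tendsto (fun h : T => ⨆ f ∈ F,
        iglsENorm Q a b ν μ (diffOp h (f : T →ₘ[μ] ℝ))) (𝓝 0) (𝓝 0) := by
  have := isFiniteMeasure_of_isAddRightInvariant μ
  have := isAddLeftInvariant_of_isAddRightInvariant μ
  have : μ.IsOpenPosMeasure :=
    isOpenPosMeasure_of_addLeftInvariant_of_compact univ isCompact_univ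
      (by simpa using NeZero.ne μ)
  refine ⟨fun hF => ⟨hF.isBounded, hF.isClosed, IGLS.tendsto_iSup_diffOp_of_isCompact _hν hF⟩,
    fun ⟨hbdd, hclosed, hlim⟩ => ?_⟩
  exact (IGLS.totallyBounded_of_tendsto_iSup_diffOp _hν hbdd hlim).isCompact_of_isClosed hclosed
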